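/- Write points of the plane as $x=(x_1,x_2)$, put $\nabla^\perp=(-\partial_2,\partial_1)$ and $(\xi_1,\xi_2)^\perp=(-\xi_2,\xi_1)$. Let $$K=\{(\rho,\mathbf v,\mathbf m)\in\mathbb R\times\mathbb R^2\times\mathbb R^2:\ |\rho|=1,\ \mathbf m=\rho\,\mathbf v\},$$ and let the wave cone $\Lambda$ be the set of all $(\rho,\mathbf v,\mathbf m)\in\mathbb R\times\mathbb R^2\times\mathbb R^2$ for which there is $\xi\in\mathbb R^2\setminus\{0\}$ with $\mathbf m\cdot\xi=0$, $\mathbf v\cdot\xi=0$ and $(\mathbf v+(0,\rho))\cdot\xi^\perp=0$. Put $K^{0,\Lambda}=K$, $$K^{k+1,\Lambda}=\{\lambda z_1+(1-\lambda)z_2:\ z_1,z_2\in K^{k,\Lambda},\ z_1-z_2\in\Lambda,\ \lambda\in[0,1]\},$$ and let $K^{lc,\Lambda}=\bigcup_{k\ge 0}K^{k,\Lambda}$ be the lamination convex hull. **Theorem.** Let $\Omega\subset\mathbb R^2$ be a bounded, simply connected, strongly Lipschitz domain, i.e. near each boundary point $\Omega$ is, in suitable Cartesian coordinates, the region strictly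 above the graph of a Lipschitz function. Let $L^2_\sigma(\Omega,\mathbb R^2)$ be the space of $\mathbf w\in L^2(\Omega,\mathbb R^2)$ with $\nabla\cdot\mathbf w=0$ in $\Omega$ and $\mathbf w\cdot\nu=0$ on $\partial\Omega$ (both in the weak sense). Suppose that $\rho\in L^\infty(\Omega)$ and $\mathbf v,\mathbf m\in L^2_\sigma(\Omega,\mathbb R^2)$ satisfy $$\nabla\cdot\mathbf m=0,\qquad \nabla\cdot\mathbf v=0,\qquad \nabla^\perp\cdot(\mathbf v+(0,\rho))=0$$ in $\Omega$ in the sense of distributions, and that $(\rho,\mathbf v,\mathbf m)(x)\in K^{lc,\Lambda}$ for a.e. $x\in\Omega$. Then $\mathbf v=\mathbf 0$ a.e. in $\Omega$ and $\partial_1\rho=0$ in $\Omega$ in the sense of distributions. -/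

import Mathlib

open MeasureTheory
open scoped ContDiff ENNReal

noncomputable section

namespace StationaryIPM

/-- The Euclidean plane `ℝ²`; the coordinates `x 0`, `x 1` are the usual `x₁`, `x₂`. -/
abbrev Plane : Type := EuclideanSpace ℝ (Fin 2)

/-- States `(ρ, v, m) ∈ ℝ × ℝ² × ℝ²`. -/
abbrev State : Type := ℝ × Plane × Plane

/-- `(a₁, a₂)^⊥ = (-a₂, a₁)`. -/
def perp (a : Plane) : Plane := !₂[-a 1, a 0]

/-- The vertical vector `(0, r)`. -/
def vert (r : ℝ) : Plane := !₂[0, r]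

/-! ### The constitutive set, the wave cone and lamination convex hulls -/

/-- The constitutive set `K = {(ρ, v, m) : |ρ| = 1, m = ρ v}`. -/
def constitutiveSet : Set State :=
  {z | |z.1| = 1 ∧ z.2.2 = z.1 • z.2.1}

/-- The wave cone `Λ`: directions `z = (ρ, v, m)` for which there is a frequency `ξ ≠ 0` such that
all plane waves `x ↦ h (x · ξ) z` solve `∇ · m = 0`, `∇ · v = 0`, `∇^⊥ · (v + (0, ρ)) = 0`,
that is, `m · ξ = 0`, `v · ξ = 0` and `(v + (0, ρ)) · ξ^⊥ = 0`. -/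
def waveCone : Set State :=
  {z | ∃ ξ : Plane, ξ ≠ 0 ∧ inner ℝ z.2.2 ξ = 0 ∧ inner ℝ z.2.1 ξ = 0 ∧
    inner ℝ (z.2.1 + vert z.1) (perp ξ) = 0}

/-- The `k`-th laminate `C^{k,Λ}` of a set `C`. -/
def laminate {V : Type*} [AddCommGroup V] [Module ℝ V] (L C : Set V) : ℕ → Set V
  | 0 => C
  | k + 1 => {z | ∃ z₁ ∈ laminate L C k, ∃ z₂ ∈ laminate L C k, z₁ - z₂ ∈ L ∧
      ∃ t ∈ Set.Icc (0 : ℝ) 1, z = t • z₁ + (1 - t) • z₂}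

/-- The lamination convex hull `C^{lc,Λ} = ⋃ₖ C^{k,Λ}`. -/
def laminationHull {V : Type*} [AddCommGroup V] [Module ℝ V] (L C : Set V) : Set V :=
  ⋃ k : ℕ, laminate L C k

/-! ### Domains -/

/-- Strongly Lipschitz: near each of its boundary points, `Ω` is, in suitable Cartesian
coordinates (obtained by a linear isometry), the region strictly above the graph of a Lipschitz
function of one variable. -/
def IsStronglyLipschitz (Ω : Set Plane) : Prop :=
  ∀ x ∈ frontier Ω, ∃ r : ℝ, 0 < r ∧ ∃ (R : Plane ≃ₗᵢ[ℝ] Plane) (g : ℝ → ℝ) (c : NNReal),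
    LipschitzWith c g ∧ ∀ y ∈ Metric.ball x r, (y ∈ Ω ↔ g (R y 0) < R y 1)

/-! ### Weak formulations -/

/-- Test functions `φ ∈ C_c^∞(Ω)`. -/
structure IsTestFunction (Ω : Set Plane) (φ : Plane → ℝ) : Prop where
  smooth : ContDiff ℝ ∞ φ
  compact : HasCompactSupport φ
  support : tsupport φ ⊆ Ω

/-- `∇ · w = 0` in `Ω` in the sense of distributions. -/
def WeakDivFree (Ω : Set Plane) (w : Plane → Plane) : Prop :=
  ∀ φ : Plane → ℝ, IsTestFunction Ω φ → ∫ x in Ω, inner ℝ (w x) (gradient φ x) = 0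

/-- `∇^⊥ · w = 0` in `Ω` in the sense of distributions, where `∇^⊥ = (-∂₂, ∂₁)`. -/
def WeakCurlFree (Ω : Set Plane) (w : Plane → Plane) : Prop :=
  ∀ φ : Plane → ℝ, IsTestFunction Ω φ → ∫ x in Ω, inner ℝ (w x) (perp (gradient φ x)) = 0

/-- `∂ᵢ f = g` in `Ω` in the sense of distributions. -/
def HasWeakPartialDeriv (Ω : Set Plane) (i : Fin 2) (f g : Plane → ℝ) : Prop :=
  ∀ φ : Plane → ℝ, IsTestFunction Ω φ →
    ∫ x in Ω, f x * gradient φ x i = -∫ x in Ω, g x * φ x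

/-- For a divergence-free field `w` on `Ω`: the normal trace `w · ν` vanishes on `∂Ω`.
By Green's formula, the normal trace of such a `w` is the functional
`φ ↦ ∫_Ω w · ∇φ` on test functions `φ` which are smooth up to the boundary. -/
def HasZeroNormalTrace (Ω : Set Plane) (w : Plane → Plane) : Prop :=
  ∀ φ : Plane → ℝ, ContDiff ℝ ∞ φ → HasCompactSupport φ →
    ∫ x in Ω, inner ℝ (w x) (gradient φ x) = 0

/-- `w ∈ L²_σ(Ω, ℝ²)`: `w ∈ L²(Ω, ℝ²)`, `∇ · w = 0` in `Ω` and `w · ν = 0` on `∂Ω`. -/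
structure MemL2Sigma (Ω : Set Plane) (w : Plane → Plane) : Prop where
  memLp : MemLp w 2 (volume.restrict Ω)
  divFree : WeakDivFree Ω w
  normalTrace : HasZeroNormalTrace Ω w

/-- The linear system `∇ · m = 0`, `∇ · v = 0`, `∇^⊥ · (v + (0, ρ)) = 0` in `Ω`. -/
structure SolvesLinearIPM (Ω : Set Plane) (ρ : Plane → ℝ) (v m : Plane → Plane) : Prop where
  div_m : WeakDivFree Ω m
  div_v : WeakDivFree Ω v
  darcy : WeakCurlFree Ω (fun x => v x + vert (ρ x))

end StationaryIPM

end

/-!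
The argument compares the system with its energy identity.

*Pointwise part.* The function `(ρ, v, m) ↦ m₂ - ρ v₂` vanishes on `K`, and it is convex along
segments in wave cone directions, because `-ρ v₂ ≥ 0` for every `(ρ, v, m) ∈ Λ`. Hence
`m₂ ≤ ρ v₂` on the whole lamination hull (`le_of_mem_laminationHull`).

*Integral part.* Since `m` has zero normal trace, `∫ m₂ = 0` (`integral_one_coord_eq_zero`). Since
`u = v + (0, ρ)` is curl-free and `v` has zero normal trace, `∫ u · v = 0`
(`integral_inner_eq_zero_of_curlFree`). Together, `∫ |v|² = -∫ ρ v₂ ≤ -∫ m₂ = 0`, so `v = 0`, and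
then the curl equation for `u = (0, ρ)` says `∂₁ρ = 0`.

*Orthogonality.* This is where the assumptions on `Ω` enter. Let `h` be the component of `u`
orthogonal in `L²(Ω)` to the gradients of functions smooth up to the boundary. Then `h` has zero
normal trace, and it is curl-free, since `u - h` is orthogonal to the rotated gradients of test
functions. So `h₁ - i h₂` is weakly holomorphic, and by Weyl's lemma
(`exists_differentiableOn_ae_eq_of_weak_dbar`) it agrees almost everywhere with a holomorphic
function. As `Ω` is simply connected, this function has a primitive
(`isExactOn_of_isSimplyConnected`), whose real part `p` satisfies `∇p = h`. The function `arctan p`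
is bounded and has square-integrable gradient; because `Ω` is strongly Lipschitz, it can be
approximated by functions smooth up to the boundary, by shifting inwards locally
(`integral_inner_gradient_eq_zero`). Testing the zero normal trace of `h` with it gives
`∫ |h|² / (1 + p²) = 0`, that is, `h = 0`. Therefore `u` is a limit of gradients, which are
orthogonal to `v`.
-/

namespace StationaryIPM

open Filter Topology Set
open scoped Convolution

/-! ### Primitives of holomorphic functions on simply connected sets -/

/-- On a simply connected space, local functions `p i` on an open cover whose differences are
locally constant can be glued, after adding constants, to a global function: the locally constant
differences are the transition functions of a covering space, which has a global section. -/
theorem exists_glue_locally_const_sub {X A : Type*} [TopologicalSpace X] [SimplyConnectedSpace X]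
    [LocallyPathConnectedSpace X] [AddCommGroup A] [TopologicalSpace A] [DiscreteTopology A]
    (U : X → Set X) (hU : ∀ x, IsOpen (U x)) (hmem : ∀ x, x ∈ U x) (p : X → X → A)
    (hp : ∀ i j, ∀ x ∈ U i ∩ U j, ∀ᶠ y in 𝓝 x, p i y - p j y = p i x - p j x) :
    ∃ P : X → A, ∀ x, ∀ᶠ y in 𝓝 x, P y - p x y = P x - p x x := by
  let Z : FiberBundleCore X X A :=
    { baseSet := U
      isOpen_baseSet := hU
      indexAt := id
      mem_baseSet_at := hmem
      coordChange := fun i j x a => a + (p i x - p j x)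
      coordChange_self := fun i x _ a => by simp
      continuousOn_coordChange := by
        rintro i j ⟨x, a⟩ ⟨hx, -⟩
        apply ContinuousAt.continuousWithinAt
        have h2 : Tendsto (fun q : X × A => q.2) (𝓝 (x, a)) (pure a) := by
          rw [← nhds_discrete A]; exact continuous_snd.continuousAt
        have h1 := (continuous_fst (X := X) (Y := A)).continuousAt (x := (x, a)) (hp i j x hx)
        refine tendsto_nhds_of_eventually_eq ?_
        filter_upwards [h1, h2 (mem_pure.2 rfl : {a} ∈ pure a)] with q hq1 hq2
        simp only [mem_preimage, mem_singleton_iff, mem_ofPred_eq] at hq1 hq2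
        rw [hq1, hq2]
      coordChange_comp := fun i j k x _ a => by abel }
  have hcov : IsCoveringMap (Bundle.TotalSpace.proj : Z.TotalSpace → X) :=
    FiberBundle.isCoveringMap (F := A) (E := Z.Fiber)
  obtain ⟨x₀⟩ : Nonempty X := inferInstance
  obtain ⟨s, ⟨-, hs⟩, -⟩ := hcov.existsUnique_continuousMap_lifts (ContinuousMap.id X) x₀
    (⟨x₀, (0 : A)⟩ : Z.TotalSpace) rfl
  have hs' : ∀ x, (s x).proj = x := fun x => congrFun hs x
  let c : X → A := fun y => (s y).2
  refine ⟨fun y => c y + p y y, fun x => ?_⟩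
  have hc : ContinuousAt (fun y => ((Z.localTriv x) (s y)).2) x := by
    have h1 : ContinuousAt (Z.localTriv x) (s x) := by
      apply (Z.localTriv x).continuousAt
      rw [FiberBundleCore.mem_localTriv_source, hs' x]
      exact hmem x
    exact continuous_snd.continuousAt.comp (h1.comp s.continuous.continuousAt)
  have hc' : ∀ᶠ y in 𝓝 x, ((Z.localTriv x) (s y)).2 = ((Z.localTriv x) (s x)).2 := by
    have := hc.tendsto
    rw [nhds_discrete A] at this
    exact this.eventually (p := fun a => a = _) (mem_pure.2 rfl)
  filter_upwards [hc'] with y hy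
  have key : ∀ y, ((Z.localTriv x) (s y)).2 = c y + (p y y - p x y) := by
    intro y
    change c y + (p (s y).proj (s y).proj - p x (s y).proj) = _
    rw [hs' y]
  rw [key, key] at hy
  rw [add_sub_assoc, hy, add_sub_assoc]

/-- **Cauchy's theorem** in primitive form. -/
theorem isExactOn_of_isSimplyConnected {U : Set ℂ} (hU : IsOpen U) (hUs : IsSimplyConnected U)
    {f : ℂ → ℂ} (hf : DifferentiableOn ℂ f U) : Complex.IsExactOn f U := by
  have := hUs.simplyConnectedSpace
  have := hU.locallyPathConnectedSpace
  have hball : ∀ x : U, ∃ r > 0, Metric.ball (x : ℂ) r ⊆ U := fun x =>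
    Metric.isOpen_iff.1 hU x x.2
  choose r hr hrU using hball
  have hprim : ∀ x : U, Complex.IsExactOn f (Metric.ball (x : ℂ) (r x)) := fun x =>
    (hf.mono (hrU x)).isExactOn_ball
  choose p hp using hprim
  obtain ⟨P, hP⟩ := @exists_glue_locally_const_sub U ℂ _ _ _ _ ⊥ (@DiscreteTopology.mk ℂ ⊥ rfl)
    (fun x => {y : U | (y : ℂ) ∈ Metric.ball (x : ℂ) (r x)})
    (fun x => Metric.isOpen_ball.preimage continuous_subtype_val)
    (fun x => Metric.mem_ball_self (hr x)) (fun x y => p x y) (by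
      rintro i j x ⟨hxi, hxj⟩
      have hopen : Metric.ball (i : ℂ) (r i) ∩ Metric.ball (j : ℂ) (r j) ∈ 𝓝 (x : ℂ) :=
        (Metric.isOpen_ball.inter Metric.isOpen_ball).mem_nhds ⟨hxi, hxj⟩
      refine continuous_subtype_val.continuousAt.eventually (p := fun z : ℂ =>
        p i z - p j z = p i x - p j x) ?_
      filter_upwards [hopen] with z hz
      have hconv := (convex_ball (i : ℂ) (r i)).inter (convex_ball (j : ℂ) (r j))
      refine hconv.is_const_of_fderivWithin_eq_zero (𝕜 := ℂ) (f := fun z => p i z - p j z)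
        ?_ ?_ hz ⟨hxi, hxj⟩
      · intro w hw
        exact ((hp i w hw.1).sub (hp j w hw.2)).differentiableAt.differentiableWithinAt
      · intro w hw
        rw [fderivWithin_of_isOpen (Metric.isOpen_ball.inter Metric.isOpen_ball) hw]
        have h := ((hp i w hw.1).sub (hp j w hw.2))
        rw [sub_self] at h
        have h2 := h.hasFDerivAt.fderiv
        ext
        simp only [Pi.sub_def] at h2
        rw [h2]
        simp)
  classical
  refine ⟨fun z => if h : z ∈ U then P ⟨z, h⟩ else 0, fun z hz => ?_⟩
  have h1 := hP ⟨z, hz⟩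
  rw [nhds_subtype_eq_comap] at h1
  have h2 : ∀ᶠ w in 𝓝 z, ∀ h : w ∈ U,
      P ⟨w, h⟩ - p ⟨z, hz⟩ w = P ⟨z, hz⟩ - p ⟨z, hz⟩ z := by
    obtain ⟨t, ht, hts⟩ := h1
    filter_upwards [ht] with w hw h
    exact hts (show (⟨w, h⟩ : U) ∈ Subtype.val ⁻¹' t from hw)
  refine ((hp ⟨z, hz⟩ z (Metric.mem_ball_self (hr _))).add_const
    (P ⟨z, hz⟩ - p ⟨z, hz⟩ z)).congr_of_eventuallyEq ?_
  filter_upwards [h2, hU.mem_nhds hz] with w hw hwU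
  rw [dif_pos hwU, ← hw hwU]
  ring

/-! ### Weyl's lemma for the Cauchy–Riemann operator -/

open ContinuousLinearMap in
/-- The mollification `φ ⋆ F` is holomorphic near points whose `φ`-neighbourhood lies in the set
where `F` is weakly holomorphic. -/
theorem differentiableAt_convolution_of_weak_dbar {U : Set ℂ} {F : ℂ → ℂ} (hF : Integrable F)
    (hdbar : ∀ φ : ℂ → ℝ, ContDiff ℝ ∞ φ → HasCompactSupport φ → tsupport φ ⊆ U →
      ∫ z, ((fderiv ℝ φ z 1 : ℂ) + Complex.I * (fderiv ℝ φ z Complex.I : ℂ)) * F z = 0)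
    {φ : ℂ → ℝ} (hφ : ContDiff ℝ ∞ φ) {ε : ℝ}
    (hφs : tsupport φ ⊆ Metric.closedBall 0 ε) {z : ℂ} (hz : Metric.closedBall z ε ⊆ U) :
    DifferentiableAt ℂ (φ ⋆[lsmul ℝ ℝ, volume] F) z := by
  have hφc : HasCompactSupport φ :=
    HasCompactSupport.of_support_subset_isCompact (isCompact_closedBall 0 ε)
      ((subset_tsupport φ).trans hφs)
  have hφ1 : ContDiff ℝ 1 φ := hφ.of_le (by simp)
  have hd := hφc.hasFDerivAt_convolution_left (lsmul ℝ ℝ) hφ1 hF.locallyIntegrable z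
  have hex : ConvolutionExistsAt (fderiv ℝ φ) F z ((lsmul ℝ ℝ : ℝ →L[ℝ] ℂ →L[ℝ] ℂ).precompL ℂ)
      volume :=
    (hφc.fderiv ℝ).convolutionExists_left _ (hφ1.continuous_fderiv one_ne_zero)
      hF.locallyIntegrable z
  have hval : ∀ v : ℂ, (fderiv ℝ φ ⋆[(lsmul ℝ ℝ : ℝ →L[ℝ] ℂ →L[ℝ] ℂ).precompL ℂ, volume] F) z v
      = ∫ t, (fderiv ℝ φ (z - t) v : ℂ) * F t := by
    intro v
    rw [convolution_def, ContinuousLinearMap.integral_apply hex]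
    rw [← integral_sub_left_eq_self _ volume z]
    simp
  have hint : ∀ v : ℂ, Integrable fun t => (fderiv ℝ φ (z - t) v : ℂ) * F t := by
    intro v
    have h1 := (hex.apply_continuousLinearMap v).comp_sub_left z
    refine h1.congr (Eventually.of_forall fun t => ?_)
    simp
  have hder : ∀ t v, fderiv ℝ (fun t => φ (z - t)) t v = - fderiv ℝ φ (z - t) v := by
    intro t v
    have h := ((hφ1.differentiable one_ne_zero (z - t)).hasFDerivAt).comp t
      ((hasFDerivAt_id t).const_sub z)
    have h' : HasFDerivAt (fun t => φ (z - t))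
      ((fderiv ℝ φ (z - t)).comp (-ContinuousLinearMap.id ℝ ℂ)) t := h
    rw [h'.fderiv]; simp
  have hweak := hdbar (fun t => φ (z - t)) (hφ.comp (contDiff_const.sub contDiff_id))
    (hφc.comp_homeomorph (Homeomorph.subLeft z)) (by
      refine (closure_minimal ?_ Metric.isClosed_closedBall).trans hz
      intro t ht
      have := hφs (subset_tsupport φ ht)
      rw [mem_closedBall_zero_iff] at this
      rwa [Metric.mem_closedBall, dist_comm, dist_eq_norm])
  rw [differentiableAt_complex_iff_differentiableAt_real]
  refine ⟨hd.differentiableAt, ?_⟩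
  rw [hd.fderiv, hval, hval]
  have h2 : ∫ t, (-((fderiv ℝ φ (z - t) 1 : ℂ) * F t) - 
      Complex.I * ((fderiv ℝ φ (z - t) Complex.I : ℂ) * F t)) = 0 := by
    rw [← hweak]
    congr 1 with t
    rw [hder, hder]
    push_cast
    ring
  have h3 := integral_sub (hint 1).neg ((hint Complex.I).const_mul Complex.I)
  simp only [Pi.neg_apply] at h3
  rw [h3, integral_neg, integral_const_mul] at h2
  rw [smul_eq_mul]
  linear_combination Complex.I * h2 +
    (∫ t, (fderiv ℝ φ (z - t) Complex.I : ℂ) * F t) * Complex.I_sq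

/-- Smooth radial mollifiers of mass one. -/
theorem exists_radial_mollifier {ε : ℝ} (hε : 0 < ε) :
    ∃ φ : ℂ → ℝ, ContDiff ℝ ∞ φ ∧ tsupport φ ⊆ Metric.closedBall 0 ε ∧ ∫ z, φ z = 1 ∧
      ∀ z w, ‖z‖ = ‖w‖ → φ z = φ w := by
  let φ₀ : ℂ → ℝ := fun z => expNegInvGlue (ε ^ 2 - ‖z‖ ^ 2)
  have hs : ContDiff ℝ ∞ φ₀ :=
    expNegInvGlue.contDiff.comp (contDiff_const.sub (contDiff_norm_sq ℝ))
  have hsup : tsupport φ₀ ⊆ Metric.closedBall 0 ε := by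
    refine closure_minimal (fun z hz => ?_) Metric.isClosed_closedBall
    by_contra hzε
    rw [mem_closedBall_zero_iff, not_le] at hzε
    exact hz (expNegInvGlue.zero_of_nonpos (by nlinarith))
  have hc : HasCompactSupport φ₀ :=
    HasCompactSupport.of_support_subset_isCompact (isCompact_closedBall 0 ε)
      ((subset_tsupport φ₀).trans hsup)
  have hpos : 0 < ∫ z, φ₀ z := by
    refine hs.continuous.integral_pos_of_hasCompactSupport_nonneg_nonzero hc
      (fun z => expNegInvGlue.nonneg _) (x := 0) ?_
    exact (expNegInvGlue.pos_of_pos (by simpa using pow_pos hε 2)).ne'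
  refine ⟨fun z => (∫ z, φ₀ z)⁻¹ * φ₀ z, contDiff_const.mul hs, ?_, ?_, ?_⟩
  · exact (tsupport_mul_subset_right).trans hsup
  · rw [integral_const_mul, inv_mul_cancel₀ hpos.ne']
  · intro z w h
    simp only [φ₀, h]

/-- The mean value property against a radial mollifier. -/
theorem convolution_radial_eq {φ : ℂ → ℝ} (hφ : Continuous φ) {ε : ℝ}
    (hφs : tsupport φ ⊆ Metric.closedBall 0 ε) (hφ1 : ∫ z, φ z = 1)
    (hrad : ∀ z w, ‖z‖ = ‖w‖ → φ z = φ w) {G : ℂ → ℂ} (hG : Continuous G) {z : ℂ} {r : ℝ}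
    (hr : ε < r) (hGd : DifferentiableOn ℂ G (Metric.ball z r)) :
    (φ ⋆[ContinuousLinearMap.lsmul ℝ ℝ, volume] G) z = G z := by
  have hφc : HasCompactSupport φ :=
    HasCompactSupport.of_support_subset_isCompact (isCompact_closedBall 0 ε)
      ((subset_tsupport φ).trans hφs)
  rw [convolution_def]
  simp only [ContinuousLinearMap.lsmul_apply]
  -- rotate the integration variable by an arbitrary angle and average over the angle
  have hrot : ∀ θ : ℝ, ∫ t, φ t • G (z - t) =
      ∫ t, φ t • G (z - t * Complex.exp (θ * Complex.I)) := by
    intro θ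
    let R : ℂ ≃ₗᵢ[ℝ] ℂ := rotation (Circle.exp θ)
    rw [← R.measurePreserving.integral_comp R.toHomeomorph.measurableEmbedding]
    congr 1 with t
    have h1 : R t = t * Complex.exp (θ * Complex.I) := by
      simp [R, rotation_apply, Circle.coe_exp, mul_comm]
    rw [hrad (R t) t (R.norm_map t), h1]
  have hmean : ∀ t, φ t • (∫ θ in (0 : ℝ)..2 * Real.pi, G (z - t * Complex.exp (θ * Complex.I))) =
      φ t • ((2 * Real.pi : ℝ) • G z) := by
    intro t
    by_cases ht : φ t = 0
    · rw [ht, zero_smul, zero_smul]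
    congr 1
    have htε : ‖t‖ ≤ ε := by
      simpa using hφs (subset_tsupport φ ht)
    have hper : Function.Periodic (fun θ : ℝ => G (z + ‖t‖ * Complex.exp (θ * Complex.I)))
        (2 * Real.pi) := by
      intro θ
      simp only
      push_cast
      rw [add_mul, Complex.exp_periodic]
    have hav : Real.circleAverage G z ‖t‖ = G z := by
      apply DiffContOnCl.circleAverage
      refine ⟨hGd.mono (Metric.ball_subset_ball (by rw [abs_norm]; linarith)), hG.continuousOn⟩
    rw [Real.circleAverage_def] at hav
    have hav' : ∫ θ in (0 : ℝ)..2 * Real.pi, G (z + ‖t‖ * Complex.exp (θ * Complex.I)) =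
        (2 * Real.pi : ℝ) • G z := by
      rw [← hav, smul_smul, mul_inv_cancel₀ (by positivity), one_smul]
      rfl
    rw [← hav']
    have harg : ∀ θ : ℝ, z - t * Complex.exp (θ * Complex.I) =
        z + ‖t‖ * Complex.exp (((θ + (t.arg + Real.pi) : ℝ)) * Complex.I) := by
      intro θ
      conv_lhs => rw [← Complex.norm_mul_exp_arg_mul_I t]
      push_cast
      rw [add_mul, add_mul, Complex.exp_add, Complex.exp_add, Complex.exp_pi_mul_I]
      ring
    simp only [harg]
    rw [intervalIntegral.integral_comp_add_right
      (fun θ : ℝ => G (z + ‖t‖ * Complex.exp (θ * Complex.I)))]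
    have := hper.intervalIntegral_add_eq (0 + (t.arg + Real.pi)) 0
    rw [zero_add] at this ⊢
    rw [zero_add] at this
    rw [← this]
    congr 1
    ring
  have hswap : ∫ θ in (0 : ℝ)..2 * Real.pi, ∫ t, φ t • G (z - t * Complex.exp (θ * Complex.I)) =
      ∫ t, ∫ θ in (0 : ℝ)..2 * Real.pi, φ t • G (z - t * Complex.exp (θ * Complex.I)) := by
    apply intervalIntegral_integral_swap
    have hcont : Continuous (Function.uncurry fun (θ : ℝ) (t : ℂ) =>
        φ t • G (z - t * Complex.exp (θ * Complex.I))) := by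
      fun_prop
    have hon : IntegrableOn (Function.uncurry fun (θ : ℝ) (t : ℂ) =>
        φ t • G (z - t * Complex.exp (θ * Complex.I)))
        (uIcc 0 (2 * Real.pi) ×ˢ Metric.closedBall (0 : ℂ) ε) (volume.prod volume) :=
      hcont.continuousOn.integrableOn_compact (isCompact_uIcc.prod (isCompact_closedBall _ _))
    have hon2 : IntegrableOn (Function.uncurry fun (θ : ℝ) (t : ℂ) =>
        φ t • G (z - t * Complex.exp (θ * Complex.I)))
        (uIcc 0 (2 * Real.pi) ×ˢ univ) (volume.prod volume) := by
      refine hon.of_forall_sdiff_eq_zero (measurableSet_uIcc.prod MeasurableSet.univ) ?_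
      rintro ⟨θ, t⟩ ⟨⟨h1, -⟩, h2⟩
      have : φ t = 0 := by
        by_contra h
        exact h2 ⟨h1, hφs (subset_tsupport φ h)⟩
      simp [Function.uncurry, this]
    have h3 := hon2.mono_set (prod_mono uIoc_subset_uIcc subset_rfl)
    rwa [IntegrableOn, ← Measure.prod_restrict, Measure.restrict_univ] at h3
  simp only [← hrot, intervalIntegral.integral_smul, hmean] at hswap
  rw [intervalIntegral.integral_const, integral_smul_const, hφ1, sub_zero, one_smul] at hswap
  exact smul_right_injective ℂ (by positivity : (2 * Real.pi : ℝ) ≠ 0) hswap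

open ContinuousLinearMap in
theorem convolution_left_comm {φ ψ : ℂ → ℝ} (hφ : Continuous φ) (hψ : Continuous ψ)
    (hφc : HasCompactSupport φ) (hψc : HasCompactSupport ψ) {F : ℂ → ℂ} (hF : Integrable F) :
    φ ⋆[lsmul ℝ ℝ, volume] (ψ ⋆[lsmul ℝ ℝ, volume] F) =
      ψ ⋆[lsmul ℝ ℝ, volume] (φ ⋆[lsmul ℝ ℝ, volume] F) := by
  have key : ∀ {φ ψ : ℂ → ℝ}, Continuous φ → Continuous ψ → HasCompactSupport φ →
      HasCompactSupport ψ → (φ ⋆[mul ℝ ℝ, volume] ψ) ⋆[lsmul ℝ ℝ, volume] F =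
        φ ⋆[lsmul ℝ ℝ, volume] (ψ ⋆[lsmul ℝ ℝ, volume] F) := by
    intro φ ψ hφ hψ hφc hψc
    ext z
    refine convolution_assoc _ _ _ _ (fun x y w => by simp [mul_smul]) hφ.aestronglyMeasurable
      hψ.aestronglyMeasurable hF.aestronglyMeasurable
      (Eventually.of_forall fun y => hφc.convolutionExists_left _ hφ hψ.locallyIntegrable y)
      (Eventually.of_forall fun y => hψc.norm.convolutionExists_left _ hψ.norm
        hF.norm.locallyIntegrable y)
      (hφc.norm.convolutionExists_left _ hφ.norm ?_ z)
    exact (hψc.norm.continuous_convolution_left _ hψ.norm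
        hF.norm.locallyIntegrable).locallyIntegrable
  rw [← key hφ hψ hφc hψc, ← key hψ hφ hψc hφc]
  congr 1
  rw [← convolution_flip]
  congr 1
  ext
  simp

open ContinuousLinearMap in
/-- **Weyl's lemma** for the Cauchy–Riemann operator: a weakly holomorphic function agrees almost
everywhere with a holomorphic one. Away from the boundary, mollification by a radial kernel `φ`
fixes the smooth approximations `ψₙ ⋆ F`, hence fixes `F`, and `φ ⋆ F` is holomorphic. -/
theorem exists_differentiableOn_ae_eq_of_weak_dbar {U : Set ℂ} (hU : IsOpen U) {F : ℂ → ℂ}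
    (hF : Integrable F)
    (hdbar : ∀ φ : ℂ → ℝ, ContDiff ℝ ∞ φ → HasCompactSupport φ → tsupport φ ⊆ U →
      ∫ z, ((fderiv ℝ φ z 1 : ℂ) + Complex.I * (fderiv ℝ φ z Complex.I : ℂ)) * F z = 0) :
    ∃ f : ℂ → ℂ, DifferentiableOn ℂ f U ∧ ∀ᵐ z, z ∈ U → F z = f z := by
  let ψ : ℕ → ContDiffBump (0 : ℂ) := fun n =>
    ⟨1 / (n + 1 : ℝ), 2 * (1 / (n + 1 : ℝ)), by positivity, by
      have : 0 < 1 / (n + 1 : ℝ) := by positivity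
      linarith⟩
  have hψr : Tendsto (fun n => (ψ n).rOut) atTop (𝓝 0) := by
    have := (tendsto_one_div_add_atTop_nhds_zero_nat (𝕜 := ℝ)).const_mul 2
    rw [mul_zero] at this
    exact this
  -- a pointwise limit, so that `f` is one function although the radius of `φ` below depends on
  -- the point
  let f : ℂ → ℂ := fun z => limUnder atTop fun n => ((ψ n).normed volume ⋆[lsmul ℝ ℝ, volume] F) z
  have hae : ∀ᵐ z, Tendsto (fun n => ((ψ n).normed volume ⋆[lsmul ℝ ℝ, volume] F) z) atTop
      (𝓝 (F z)) :=
    ContDiffBump.ae_convolution_tendsto_right_of_locallyIntegrable (K := 2) hψr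
      (Eventually.of_forall fun n => le_rfl) hF.locallyIntegrable
  refine ⟨f, fun z₀ hz₀ => ?_, hae.mono fun z hz _ => hz.limUnder_eq.symm⟩
  obtain ⟨R, hR, hRU⟩ := Metric.isOpen_iff.1 hU z₀ hz₀
  obtain ⟨ε, hε, rfl⟩ : ∃ ε : ℝ, 0 < ε ∧ R = 4 * ε := ⟨R / 4, by positivity, by ring⟩
  obtain ⟨φ, hφ, hφs, hφ1, hrad⟩ := exists_radial_mollifier hε
  have hφc : HasCompactSupport φ :=
    HasCompactSupport.of_support_subset_isCompact (isCompact_closedBall 0 ε)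
      ((subset_tsupport φ).trans hφs)
  have hψsmooth : ∀ n, ContDiff ℝ ∞ ((ψ n).normed volume) := fun n => (ψ n).contDiff_normed
  have hψc : ∀ n, HasCompactSupport ((ψ n).normed volume) := fun n =>
    (ψ n).hasCompactSupport_normed
  have hclosed : ∀ {z : ℂ} {s : ℝ}, dist z z₀ + s < 4 * ε → Metric.closedBall z s ⊆ U := by
    intro z s hzs w hw
    apply hRU
    rw [Metric.mem_closedBall] at hw
    rw [Metric.mem_ball]
    linarith [dist_triangle w z z₀]
  have hfeq : ∀ z ∈ Metric.ball z₀ ε, f z = (φ ⋆[lsmul ℝ ℝ, volume] F) z := by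
    intro z hz
    rw [Metric.mem_ball] at hz
    have hcont : Continuous (φ ⋆[lsmul ℝ ℝ, volume] F) :=
      hφc.continuous_convolution_left _ hφ.continuous hF.locallyIntegrable
    have hlim := ContDiffBump.convolution_tendsto_right_of_continuous (μ := volume) hψr hcont z
    refine (hlim.congr' ?_).limUnder_eq
    filter_upwards [hψr.eventually (gt_mem_nhds hε)] with n hn
    rw [← convolution_left_comm hφ.continuous (hψsmooth n).continuous hφc (hψc n) hF]
    refine convolution_radial_eq hφ.continuous hφs hφ1 hrad
      ((hψc n).continuous_convolution_left _ (hψsmooth n).continuous hF.locallyIntegrable)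
      (r := 2 * ε) (by linarith) fun w hw => ?_
    rw [Metric.mem_ball] at hw
    refine (differentiableAt_convolution_of_weak_dbar hF hdbar (hψsmooth n)
      (ε := (ψ n).rOut) (by rw [(ψ n).tsupport_normed_eq]) (hclosed ?_)).differentiableWithinAt
    linarith [dist_triangle w z z₀]
  refine ((differentiableAt_convolution_of_weak_dbar hF hdbar hφ hφs
    (hclosed (z := z₀) (s := ε) (by rw [dist_self]; linarith))).congr_of_eventuallyEq
    ?_).differentiableWithinAt
  filter_upwards [Metric.ball_mem_nhds z₀ hε] with z hz using hfeq z hz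

/-! ### Testing the zero normal trace with functions that are rough at the boundary -/

theorem contDiff_mul_of_tsupport_subset {E : Type*} [NormedAddCommGroup E] [NormedSpace ℝ E]
    {V : Set E} (hV : IsOpen V) {χ f : E → ℝ} (hχ : ContDiff ℝ ∞ χ) (hχV : tsupport χ ⊆ V)
    (hf : ContDiffOn ℝ ∞ f V) : ContDiff ℝ ∞ fun x => χ x * f x := by
  rw [contDiff_iff_contDiffAt]
  intro x
  by_cases hx : x ∈ tsupport χ
  · exact hχ.contDiffAt.mul (hf.contDiffAt (hV.mem_nhds (hχV hx)))
  · refine (contDiffAt_const (c := (0 : ℝ))).congr_of_eventuallyEq ?_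
    filter_upwards [(isClosed_tsupport χ).isOpen_compl.mem_nhds hx] with y hy
    rw [image_eq_zero_of_notMem_tsupport hy, zero_mul]

open scoped Manifold in
theorem exists_smooth_cutoff {E : Type*} [NormedAddCommGroup E] [NormedSpace ℝ E]
    [FiniteDimensional ℝ E] {K V : Set E} (hK : IsCompact K) (hV : IsOpen V) (hKV : K ⊆ V) :
    ∃ χ : E → ℝ, ContDiff ℝ ∞ χ ∧ HasCompactSupport χ ∧ tsupport χ ⊆ V ∧
      ∀ x ∈ K, ∀ᶠ y in 𝓝 x, χ y = 1 := by
  obtain ⟨L, hL, hKL, hLV⟩ := exists_compact_between hK hV hKV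
  obtain ⟨f, hf0, hf1, -⟩ := exists_contMDiffMap_zero_one_nhds_of_isClosed 𝓘(ℝ, E) (n := (⊤ : ℕ∞))
    (isOpen_interior (s := L)).isClosed_compl hK.isClosed
    (disjoint_compl_left_iff_subset.2 hKL)
  have hsup : tsupport f ⊆ L := by
    refine closure_minimal (fun x hx => ?_) hL.isClosed
    by_contra hxL
    exact hx (hf0.self_of_nhdsSet x fun h => hxL (interior_subset h))
  refine ⟨f, f.contMDiff.contDiff, HasCompactSupport.of_support_subset_isCompact hL
    ((subset_tsupport _).trans hsup), hsup.trans hLV, fun x hx => ?_⟩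
  exact hf1.filter_mono (nhds_le_nhdsSet hx)

theorem gradient_congr {f g : Plane → ℝ} {x : Plane} (h : f =ᶠ[𝓝 x] g) :
    gradient f x = gradient g x := by
  rw [gradient, gradient, h.fderiv_eq]

theorem gradient_eq_zero_of_eventually {f : Plane → ℝ} {x : Plane} (h : ∀ᶠ y in 𝓝 x, f y = 0) :
    gradient f x = 0 := by
  rw [gradient_congr (g := fun _ => 0) h]
  exact gradient_fun_const x 0

theorem gradient_comp_add_right (f : Plane → ℝ) (a x : Plane) :
    gradient (fun y => f (y + a)) x = gradient f (x + a) := by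
  rw [gradient, gradient, fderiv_comp_add_right]

theorem gradient_fun_mul {f g : Plane → ℝ} {x : Plane} (hf : DifferentiableAt ℝ f x)
    (hg : DifferentiableAt ℝ g x) :
    gradient (fun y => f y * g y) x = f x • gradient g x + g x • gradient f x := by
  simp only [gradient]
  rw [fderiv_fun_mul hf hg, map_add, map_smulₛₗ, map_smulₛₗ]
  simp

theorem continuous_gradient {φ : Plane → ℝ} (hφ : ContDiff ℝ ∞ φ) :
    Continuous (gradient φ) :=
  (InnerProductSpace.toDual ℝ Plane).symm.continuous.comp (hφ.continuous_fderiv (by simp))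

theorem hasCompactSupport_gradient {φ : Plane → ℝ} (hφ : HasCompactSupport φ) :
    HasCompactSupport (gradient φ) :=
  (hφ.fderiv ℝ).comp_left (g := (InnerProductSpace.toDual ℝ Plane).symm) (map_zero _)

theorem gradient_apply_eq (f : Plane → ℝ) (x v : Plane) :
    inner ℝ (gradient f x) v = fderiv ℝ f x v := by
  rw [gradient, InnerProductSpace.toDual_symm_apply]

theorem integrable_inner_of_memLp {μ : Measure Plane} {f g : Plane → Plane} (hf : MemLp f 2 μ)
    (hg : MemLp g 2 μ) : Integrable (fun x => inner ℝ (f x) (g x)) μ := by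
  refine (L2.integrable_inner (𝕜 := ℝ) (hf.toLp f) (hg.toLp g)).congr ?_
  filter_upwards [hf.coeFn_toLp, hg.coeFn_toLp] with x hx hx'
  rw [hx, hx']

/-- Translations are continuous in `L²`, tested against a fixed field. -/
theorem tendsto_integral_inner_translate {h W : Plane → Plane} (hh : MemLp h 2) (hW : MemLp W 2)
    (e : Plane) :
    Tendsto (fun t : ℝ => ∫ x, inner ℝ (h x) (W (x + t • e))) (𝓝 0)
      (𝓝 (∫ x, inner ℝ (h x) (W x))) := by
  have : Fact ((1 : ℝ≥0∞) ≤ 2) := ⟨by norm_num⟩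
  let G : C(ℝ × Plane, Plane) := ⟨fun p => p.2 + p.1 • e, by fun_prop⟩
  have hmp : ∀ t : ℝ, MeasurePreserving (G.curry t) (volume : Measure Plane) volume := fun t =>
    measurePreserving_add_right volume (t • e)
  have hc : Continuous fun t : ℝ => Lp.compMeasurePreserving (G.curry t) (hmp t) (hW.toLp W) :=
    Continuous.compMeasurePreservingLp continuous_const G.curry.continuous hmp (by simp)
  have hc2 : Continuous fun t : ℝ => inner ℝ (hh.toLp h)
      (Lp.compMeasurePreserving (G.curry t) (hmp t) (hW.toLp W)) :=
    continuous_const.inner hc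
  have hval : ∀ t : ℝ, inner ℝ (hh.toLp h)
      (Lp.compMeasurePreserving (G.curry t) (hmp t) (hW.toLp W)) =
      ∫ x, inner ℝ (h x) (W (x + t • e)) := by
    intro t
    rw [L2.inner_def]
    apply integral_congr_ae
    rw [Lp.toLp_compMeasurePreserving]
    filter_upwards [hh.coeFn_toLp, (hW.comp_measurePreserving (hmp t)).coeFn_toLp] with x hx hx2
    rw [hx, hx2]
    rfl
  have := hc2.tendsto 0
  simp only [hval, zero_smul, add_zero] at this
  exact this

theorem setIntegral_inner_eq_indicator {Ω : Set Plane} (hΩ : MeasurableSet Ω)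
    (h W : Plane → Plane) :
    ∫ x in Ω, inner ℝ (h x) (W x) = ∫ x, inner ℝ (Ω.indicator h x) (W x) := by
  rw [← integral_indicator hΩ]
  congr 1 with x
  by_cases hx : x ∈ Ω <;> simp [hx]

/-- A function supported near a boundary point, where `Ω` is a Lipschitz epigraph, can be shifted
inwards; the shifts are smooth up to the boundary, hence admissible in the definition of the normal
trace. -/
theorem integral_inner_gradient_eq_zero_of_epigraph {Ω : Set Plane} (hΩ : IsOpen Ω)
    (hb : Bornology.IsBounded Ω) {h : Plane → Plane} (hh : MemLp h 2 (volume.restrict Ω))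
    (hn : HasZeroNormalTrace Ω h) {x₀ : Plane} {r : ℝ} (R : Plane ≃ₗᵢ[ℝ] Plane) {g : ℝ → ℝ}
    (hg : Continuous g) (hgr : ∀ y ∈ Metric.ball x₀ r, (y ∈ Ω ↔ g (R y 0) < R y 1))
    {w : Plane → ℝ} (hw : ContDiffOn ℝ ∞ w Ω) (hwc : HasCompactSupport w)
    (hws : tsupport w ⊆ Metric.ball x₀ r)
    (hwL : MemLp (gradient w) 2 (volume.restrict Ω)) :
    ∫ x in Ω, inner ℝ (h x) (gradient w x) = 0 := by
  let e : Plane := R.symm !₂[0, 1]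
  have hR0 : ∀ (y : Plane) (t : ℝ), R (y + t • e) 0 = R y 0 := by
    intro y t; simp [e]
  have hR1 : ∀ (y : Plane) (t : ℝ), R (y + t • e) 1 = R y 1 + t := by
    intro y t; simp [e]
  have hclos : ∀ y ∈ closure Ω ∩ Metric.ball x₀ r, g (R y 0) ≤ R y 1 := by
    rintro y ⟨hy, hyb⟩
    have hyc : y ∈ closure (Ω ∩ Metric.ball x₀ r) := by
      rw [inter_comm]
      exact Metric.isOpen_ball.inter_closure ⟨hyb, hy⟩
    have hcl : IsClosed {y : Plane | g (R y 0) ≤ R y 1} := by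
      refine isClosed_le (hg.comp ?_) ?_ <;> fun_prop
    exact closure_minimal (fun z hz => ((hgr z hz.2).1 hz.1).le) hcl hyc
  let W : Plane → Plane := Ω.indicator (gradient w)
  have hWL : MemLp W 2 := (memLp_indicator_iff_restrict hΩ.measurableSet).2 hwL
  have hhL : MemLp (Ω.indicator h) 2 := (memLp_indicator_iff_restrict hΩ.measurableSet).2 hh
  obtain ⟨δ, hδ, hδs⟩ := hwc.isCompact.exists_thickening_subset_open Metric.isOpen_ball hws
  have hsmall : ∀ᶠ t : ℝ in 𝓝[>] 0, ∀ y, y + t • e ∈ tsupport w → y ∈ Metric.ball x₀ r := by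
    have hcont : ContinuousAt (fun t : ℝ => ‖t • e‖) 0 := by fun_prop
    have h0 : ∀ᶠ t : ℝ in 𝓝 0, ‖t • e‖ < δ := by
      refine hcont.eventually (gt_mem_nhds ?_)
      simpa using hδ
    filter_upwards [nhdsWithin_le_nhds h0] with t ht y hy
    refine hδs (Metric.mem_thickening_iff.2 ⟨_, hy, ?_⟩)
    simpa [dist_eq_norm] using ht
  have hshift : ∀ᶠ t : ℝ in 𝓝[>] 0, ∫ x, inner ℝ (Ω.indicator h x) (W (x + t • e)) = 0 := by
    filter_upwards [hsmall, self_mem_nhdsWithin] with t ht htpos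
    rw [mem_Ioi] at htpos
    rw [← setIntegral_inner_eq_indicator hΩ.measurableSet h fun x => W (x + t • e)]
    have hτ : Continuous fun y : Plane => y + t • e := by fun_prop
    let V : Set Plane := (fun y => y + t • e) ⁻¹' Ω
    let K : Set Plane := closure Ω ∩ (fun y => y + t • e) ⁻¹' tsupport w
    have hK : IsCompact K :=
      hb.isCompact_closure.inter_right ((isClosed_tsupport w).preimage hτ)
    have hKV : K ⊆ V := by
      rintro y ⟨hy, hyw⟩
      refine (hgr _ (hws hyw)).2 ?_
      rw [hR0, hR1]
      linarith [hclos y ⟨hy, ht y hyw⟩]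
    obtain ⟨χ, hχ, hχc, hχV, hχ1⟩ := exists_smooth_cutoff hK (hΩ.preimage hτ) hKV
    rw [← hn (fun x => χ x * w (x + t • e))
      (contDiff_mul_of_tsupport_subset (hΩ.preimage hτ) hχ hχV
        (hw.comp (by fun_prop) fun _ hx => hx)) hχc.mul_right]
    refine setIntegral_congr_fun hΩ.measurableSet fun x hx => ?_
    have hgrad : gradient (fun x => χ x * w (x + t • e)) x = W (x + t • e) := by
      by_cases hxs : x + t • e ∈ tsupport w
      · have hxK : x ∈ K := ⟨subset_closure hx, hxs⟩
        have hxΩ : x + t • e ∈ Ω := hKV hxK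
        rw [gradient_congr (g := fun y => w (y + t • e)), gradient_comp_add_right]
        · simp only [W, indicator_of_mem hxΩ]
        · filter_upwards [hχ1 x hxK] with y hy
          rw [hy, one_mul]
      · have hev : ∀ᶠ y in 𝓝 (x + t • e), w y = 0 := by
          filter_upwards [(isClosed_tsupport w).isOpen_compl.mem_nhds hxs] with y hy
          exact image_eq_zero_of_notMem_tsupport hy
        have h1 : W (x + t • e) = 0 := by
          exact indicator_apply_eq_zero.2 fun _ => gradient_eq_zero_of_eventually hev
        rw [h1]
        apply gradient_eq_zero_of_eventually
        filter_upwards [hτ.continuousAt.eventually hev] with y hy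
        rw [hy, mul_zero]
    simp only [hgrad]
  have hlim := (tendsto_integral_inner_translate hhL hWL e).mono_left
    (nhdsWithin_le_nhds (s := Ioi 0))
  have hzero := tendsto_nhds_unique (hlim.congr' hshift) tendsto_const_nhds
  rw [setIntegral_inner_eq_indicator hΩ.measurableSet, ← hzero]
  congr 1 with x
  by_cases hx : x ∈ Ω <;> simp [hx, W]

/-- On a bounded strongly Lipschitz domain, an `L²` field with zero normal trace is orthogonal to
the gradient of every bounded smooth function on `Ω` with square-integrable gradient; no regularity up
to the boundary is assumed. -/
theorem integral_inner_gradient_eq_zero {Ω : Set Plane} (hΩ : IsOpen Ω)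
    (hb : Bornology.IsBounded Ω) (hl : IsStronglyLipschitz Ω) {h : Plane → Plane}
    (hh : MemLp h 2 (volume.restrict Ω)) (hn : HasZeroNormalTrace Ω h) {q : Plane → ℝ}
    (hq : ContDiffOn ℝ ∞ q Ω) {C : ℝ} (hqC : ∀ x ∈ Ω, |q x| ≤ C)
    (hqL : MemLp (gradient q) 2 (volume.restrict Ω)) :
    ∫ x in Ω, inner ℝ (h x) (gradient q x) = 0 := by
  have hfin : IsFiniteMeasure (volume.restrict Ω) :=
    isFiniteMeasure_restrict.2 hb.measure_lt_top.ne
  have hqd : ∀ x ∈ Ω, DifferentiableAt ℝ q x := fun x hx =>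
    (hq.contDiffAt (hΩ.mem_nhds hx)).differentiableAt (by simp)
  -- products with cutoff functions have square-integrable gradient because `q` is bounded
  have hprod : ∀ η : Plane → ℝ, ContDiff ℝ ∞ η → HasCompactSupport η →
      MemLp (gradient fun x => η x * q x) 2 (volume.restrict Ω) := by
    intro η hη hηc
    have h1 : MemLp (fun x => η x • gradient q x) 2 (volume.restrict Ω) := by
      obtain ⟨B, hB⟩ := hη.continuous.bounded_above_of_compact_support hηc
      refine hqL.of_le_mul (c := B) (hη.continuous.aestronglyMeasurable.smul hqL.1)
        (Eventually.of_forall fun x => ?_)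
      rw [norm_smul]
      exact mul_le_mul_of_nonneg_right (hB x) (norm_nonneg _)
    have h2 : MemLp (fun x => q x • gradient η x) 2 (volume.restrict Ω) := by
      obtain ⟨B, hB⟩ := (continuous_gradient hη).bounded_above_of_compact_support
        (hasCompactSupport_gradient hηc)
      refine MemLp.of_bound ((hq.continuousOn.aestronglyMeasurable hΩ.measurableSet).smul
        (continuous_gradient hη).aestronglyMeasurable) (C * B) ?_
      filter_upwards [ae_restrict_mem hΩ.measurableSet] with x hx
      rw [norm_smul]
      exact mul_le_mul (hqC x hx) (hB x) (norm_nonneg _) ((abs_nonneg _).trans (hqC x hx))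
    refine (h1.add h2).ae_eq ?_
    filter_upwards [ae_restrict_mem hΩ.measurableSet] with x hx
    exact (gradient_fun_mul (hη.differentiable (by simp) x) (hqd x hx)).symm
  have hlocal : ∀ x ∈ closure Ω, ∃ s > 0, ∀ η : Plane → ℝ, ContDiff ℝ ∞ η →
      tsupport η ⊆ Metric.ball x s →
        ∫ x in Ω, inner ℝ (h x) (gradient (fun x => η x * q x) x) = 0 := by
    intro x hx
    have hcs : ∀ {η : Plane → ℝ} {s : ℝ}, tsupport η ⊆ Metric.ball x s → HasCompactSupport η :=
      fun {η s} hs => HasCompactSupport.of_support_subset_isCompact (isCompact_closedBall x s)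
        (((subset_tsupport η).trans hs).trans Metric.ball_subset_closedBall)
    by_cases hxΩ : x ∈ Ω
    · obtain ⟨s, hs, hsΩ⟩ := Metric.isOpen_iff.1 hΩ x hxΩ
      refine ⟨s, hs, fun η hη hηs => ?_⟩
      exact hn _ (contDiff_mul_of_tsupport_subset hΩ hη (hηs.trans hsΩ) hq) (hcs hηs).mul_right
    · have hxf : x ∈ frontier Ω := by
        rw [frontier, hΩ.interior_eq]; exact ⟨hx, hxΩ⟩
      obtain ⟨s, hs, R, g, c, hg, hgs⟩ := hl x hxf
      refine ⟨s, hs, fun η hη hηs => ?_⟩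
      exact integral_inner_gradient_eq_zero_of_epigraph hΩ hb hh hn R hg.continuous hgs
        (hη.contDiffOn.mul hq) (hcs hηs).mul_right
        (tsupport_mul_subset_left.trans hηs) (hprod η hη (hcs hηs))
  choose! s hs hsη using hlocal
  obtain ⟨T, hT, hTcov⟩ := hb.isCompact_closure.elim_nhds_subcover (fun x => Metric.ball x (s x))
    fun x hx => Metric.ball_mem_nhds x (hs x hx)
  obtain ⟨η, hη⟩ := SmoothPartitionOfUnity.exists_isSubordinate (modelWithCornersSelf ℝ Plane)
    (isClosed_closure (s := Ω)) (fun x : T => Metric.ball (x : Plane) (s x))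
    (fun _ => Metric.isOpen_ball) (by simpa [iUnion_subtype] using hTcov)
  have hηd : ∀ i, ContDiff ℝ ∞ (η i) := fun i => (η i).contMDiff.contDiff
  have hηc : ∀ i, HasCompactSupport (η i) := fun i =>
    HasCompactSupport.of_support_subset_isCompact (isCompact_closedBall (i : Plane) (s i))
      (((subset_tsupport _).trans (hη i)).trans Metric.ball_subset_closedBall)
  have hsum : ∀ x ∈ Ω, gradient q x = ∑ i, gradient (fun y => η i y * q y) x := by
    intro x hx
    have hev : q =ᶠ[𝓝 x] fun y => ∑ i, η i y * q y := by
      filter_upwards [hΩ.mem_nhds hx] with y hy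
      have := η.sum_eq_one (subset_closure hy)
      rw [finsum_eq_sum_of_fintype] at this
      rw [← Finset.sum_mul, this, one_mul]
    rw [gradient_congr hev]
    simp only [gradient]
    rw [fderiv_fun_sum fun i _ => ((hηd i).differentiable (by simp) x).fun_mul (hqd x hx), map_sum]
  rw [setIntegral_congr_fun hΩ.measurableSet (g := fun x =>
    ∑ i, inner ℝ (h x) (gradient (fun y => η i y * q y) x)) fun x hx => by
      simp only [hsum x hx, inner_sum]]
  rw [integral_finsetSum _ fun i _ => integrable_inner_of_memLp hh (hprod _ (hηd i) (hηc i))]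
  exact Finset.sum_eq_zero fun i _ => hsη i (hT i i.2) _ (hηd i) (hη i)

/-! ### Orthogonality of curl-free fields and fields with zero normal trace -/

theorem inner_eq_sum (a b : Plane) : inner ℝ a b = a 0 * b 0 + a 1 * b 1 := by
  simp [PiLp.inner_apply, Fin.sum_univ_two, mul_comm]

@[simp] theorem perp_zero_coord (a : Plane) : perp a 0 = -a 1 := rfl

@[simp] theorem perp_one_coord (a : Plane) : perp a 1 = a 0 := rfl

@[simp] theorem vert_zero_coord (r : ℝ) : vert r 0 = 0 := rfl

@[simp] theorem vert_one_coord (r : ℝ) : vert r 1 = r := rfl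

theorem continuous_perp : Continuous perp := by
  unfold perp
  fun_prop

theorem perp_zero : perp 0 = 0 := by
  ext i; fin_cases i <;> simp [perp]

theorem gradient_zero_coord (f : Plane → ℝ) (x : Plane) :
    gradient f x 0 = fderiv ℝ f x (EuclideanSpace.single 0 1) := by
  rw [← gradient_apply_eq, inner_eq_sum]; simp

theorem gradient_one_coord (f : Plane → ℝ) (x : Plane) :
    gradient f x 1 = fderiv ℝ f x (EuclideanSpace.single 1 1) := by
  rw [← gradient_apply_eq, inner_eq_sum]; simp

theorem memLp_gradient {φ : Plane → ℝ} (hφ : ContDiff ℝ ∞ φ) (hφc : HasCompactSupport φ)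
    (Ω : Set Plane) : MemLp (gradient φ) 2 (volume.restrict Ω) :=
  ((continuous_gradient hφ).memLp_of_hasCompactSupport
    (hasCompactSupport_gradient hφc)).restrict Ω

theorem memLp_perp_gradient {φ : Plane → ℝ} (hφ : ContDiff ℝ ∞ φ) (hφc : HasCompactSupport φ)
    (Ω : Set Plane) : MemLp (fun x => perp (gradient φ x)) 2 (volume.restrict Ω) :=
  ((continuous_perp.comp (continuous_gradient hφ)).memLp_of_hasCompactSupport
    ((hasCompactSupport_gradient hφc).comp_left perp_zero)).restrict Ω

/-- Integrating by parts twice, by the symmetry of second derivatives. -/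
theorem integral_fderiv_mul_fderiv_comm {φ ψ : Plane → ℝ} (hφ : ContDiff ℝ ∞ φ)
    (hψ : ContDiff ℝ ∞ ψ) (hψc : HasCompactSupport ψ) (a b : Plane) :
    ∫ x, fderiv ℝ φ x a * fderiv ℝ ψ x b = ∫ x, fderiv ℝ φ x b * fderiv ℝ ψ x a := by
  have hψ' : ContDiff ℝ ∞ (fderiv ℝ ψ) := hψ.fderiv_right (by simp)
  have hd : ∀ c, ContDiff ℝ ∞ fun x => fderiv ℝ ψ x c := fun c => hψ'.clm_apply contDiff_const
  have hdc : ∀ c, HasCompactSupport fun x => fderiv ℝ ψ x c := fun c => hψc.fderiv_apply ℝ c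
  have hφd : ∀ c, Continuous fun x => fderiv ℝ φ x c := fun c =>
    (hφ.continuous_fderiv (by simp)).clm_apply continuous_const
  have hparts : ∀ c d, ∫ x, fderiv ℝ φ x c * fderiv ℝ ψ x d =
      - ∫ x, φ x * fderiv ℝ (fderiv ℝ ψ) x c d := by
    intro c d
    have h2 : ∀ x, fderiv ℝ (fun y => fderiv ℝ ψ y d) x c = fderiv ℝ (fderiv ℝ ψ) x c d := by
      intro x
      rw [fderiv_clm_apply (hψ'.differentiable (by simp) x) (differentiableAt_const d)]
      simp
    have hc2 : Continuous fun x => fderiv ℝ (fun y => fderiv ℝ ψ y d) x c :=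
      ((hd d).continuous_fderiv (by simp)).clm_apply continuous_const
    have := integral_mul_fderiv_eq_neg_fderiv_mul_of_integrable (μ := (volume : Measure Plane))
      (f := φ) (g := fun y => fderiv ℝ ψ y d) (v := c)
      (((hφd c).mul (hd d).continuous).integrable_of_hasCompactSupport (hdc d).mul_left)
      ((hφ.continuous.mul hc2).integrable_of_hasCompactSupport
        ((hdc d).fderiv_apply ℝ c).mul_left)
      ((hφ.continuous.mul (hd d).continuous).integrable_of_hasCompactSupport (hdc d).mul_left)
      (fun x _ => hφ.differentiable (by simp) x) (fun x _ => (hd d).differentiable (by simp) x)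
    simp only [h2] at this
    rw [this, neg_neg]
  rw [hparts, hparts]
  congr 2 with x
  have hmin : minSmoothness ℝ 2 ≤ ((⊤ : ℕ∞) : WithTop ℕ∞) := by
    rw [minSmoothness_of_isRCLikeNormedField]
    exact WithTop.coe_le_coe.2 (le_top : (2 : ℕ∞) ≤ ⊤)
  rw [(hψ.contDiffAt.isSymmSndFDerivAt (x := x) hmin) a b]

theorem weakCurlFree_gradient {Ω : Set Plane} {φ : Plane → ℝ}
    (hφ : ContDiff ℝ ∞ φ) : WeakCurlFree Ω (gradient φ) := by
  intro ψ hψ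
  have hψ' := hψ.smooth
  rw [setIntegral_eq_integral_of_forall_compl_eq_zero]
  · have hφd : ∀ c, Continuous fun x => fderiv ℝ φ x c := fun c =>
      (hφ.continuous_fderiv (by simp)).clm_apply continuous_const
    have hψd : ∀ c, Continuous fun x => fderiv ℝ ψ x c := fun c =>
      (hψ'.continuous_fderiv (by simp)).clm_apply continuous_const
    have hint : ∀ c d, Integrable fun x => fderiv ℝ φ x c * fderiv ℝ ψ x d := fun c d =>
      ((hφd c).mul (hψd d)).integrable_of_hasCompactSupport
        (hψ.compact.fderiv_apply ℝ d).mul_left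
    have h := integral_fderiv_mul_fderiv_comm hφ hψ' hψ.compact (EuclideanSpace.single 1 1)
      (EuclideanSpace.single 0 1)
    rw [← sub_eq_zero, ← integral_sub (hint _ _) (hint _ _)] at h
    rw [← h]
    congr 1 with x
    rw [inner_eq_sum, perp_zero_coord, perp_one_coord, gradient_zero_coord, gradient_one_coord,
      gradient_zero_coord, gradient_one_coord]
    ring
  · intro x hx
    have : gradient ψ x = 0 := by
      apply gradient_eq_zero_of_eventually
      filter_upwards [(isClosed_tsupport ψ).isOpen_compl.mem_nhds fun h => hx (hψ.support h)]
        with y hy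
      exact image_eq_zero_of_notMem_tsupport hy
    rw [this, perp_zero, inner_zero_right]

/-- The classes in `L²(Ω)` of gradients of functions smooth up to the boundary. -/
noncomputable def gradientSpace (Ω : Set Plane) : Submodule ℝ (Lp Plane 2 (volume.restrict Ω)) :=
  Submodule.span ℝ {g | ∃ φ : Plane → ℝ, ContDiff ℝ ∞ φ ∧ HasCompactSupport φ ∧
    g =ᵐ[volume.restrict Ω] gradient φ}

/-- The orthogonal complement of the gradients consists of the fields with zero normal trace. -/
theorem mem_gradientSpace_orthogonal {Ω : Set Plane} {h : Lp Plane 2 (volume.restrict Ω)} :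
    h ∈ (gradientSpace Ω)ᗮ ↔ HasZeroNormalTrace Ω h := by
  have hinner : ∀ (g : Lp Plane 2 (volume.restrict Ω)) (φ : Plane → ℝ),
      g =ᵐ[volume.restrict Ω] gradient φ →
      inner ℝ h g = ∫ x in Ω, inner ℝ (h x) (gradient φ x) := by
    intro g φ hg
    rw [L2.inner_def]
    apply integral_congr_ae
    filter_upwards [hg] with x hx
    rw [hx]
  rw [Submodule.mem_orthogonal']
  constructor
  · intro H φ hφ hφc
    have hm := memLp_gradient hφ hφc Ω
    rw [← hinner (hm.toLp _) φ hm.coeFn_toLp]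
    exact H _ (Submodule.subset_span ⟨φ, hφ, hφc, hm.coeFn_toLp⟩)
  · intro H g hg
    induction hg using Submodule.span_induction with
    | mem g hg =>
      obtain ⟨φ, hφ, hφc, hgφ⟩ := hg
      rw [hinner g φ hgφ, H φ hφ hφc]
    | zero => simp
    | add x y _ _ hx hy => rw [inner_add_right, hx, hy, add_zero]
    | smul a x _ hx => rw [inner_smul_right, hx, mul_zero]

/-- The divergence and the curl are the real and imaginary parts of the Cauchy–Riemann operator
acting on `h₁ - i h₂`, so a field that is weakly free of both is weakly holomorphic in this sense.
The plane is identified with `ℂ` by `Complex.orthonormalBasisOneI.repr`. -/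
theorem weak_dbar_of_div_curl_free {Ω : Set Plane} (hΩ : IsOpen Ω) {h : Plane → Plane}
    (hh : MemLp h 2 (volume.restrict Ω)) (hdiv : WeakDivFree Ω h) (hcurl : WeakCurlFree Ω h)
    {φ : ℂ → ℝ} (hφ : ContDiff ℝ ∞ φ) (hφc : HasCompactSupport φ)
    (hφs : tsupport φ ⊆ Complex.orthonormalBasisOneI.repr ⁻¹' Ω) :
    ∫ z, ((fderiv ℝ φ z 1 : ℂ) + Complex.I * (fderiv ℝ φ z Complex.I : ℂ)) *
      Ω.indicator (fun x => (h x 0 : ℂ) - Complex.I * (h x 1 : ℂ))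
        (Complex.orthonormalBasisOneI.repr z) = 0 := by
  let J : ℂ ≃ₗᵢ[ℝ] Plane := Complex.orthonormalBasisOneI.repr
  let ψ : Plane → ℝ := fun x => φ (J.symm x)
  have hψ : IsTestFunction Ω ψ := by
    refine ⟨hφ.comp J.symm.contDiff, hφc.comp_homeomorph J.symm.toHomeomorph, ?_⟩
    intro x hx
    have h1 : tsupport ψ ⊆ J.symm ⁻¹' tsupport φ :=
      closure_minimal (fun y hy => subset_tsupport φ hy)
        ((isClosed_tsupport φ).preimage J.symm.continuous)
    have := hφs (h1 hx)
    rwa [mem_preimage, show Complex.orthonormalBasisOneI.repr (J.symm x) = x from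
      J.apply_symm_apply x] at this
  have hder : ∀ x v, fderiv ℝ ψ x v = fderiv ℝ φ (J.symm x) (J.symm v) := by
    intro x v
    have h1 := (hφ.differentiable (by simp) (J.symm x)).hasFDerivAt.comp x
      J.symm.toContinuousLinearEquiv.hasFDerivAt
    have h2 : fderiv ℝ ψ x = _ := h1.fderiv
    rw [h2]
    rfl
  have hJ0 : J.symm (EuclideanSpace.single 0 1) = 1 := by
    rw [LinearIsometryEquiv.symm_apply_eq]
    ext i
    fin_cases i <;> simp [J]
  have hJ1 : J.symm (EuclideanSpace.single 1 1) = Complex.I := by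
    rw [LinearIsometryEquiv.symm_apply_eq]
    ext i
    fin_cases i <;> simp [J]
  rw [← J.symm.measurePreserving.integral_comp J.symm.toHomeomorph.measurableEmbedding]
  have hstep : ∫ x, ((fderiv ℝ φ (J.symm x) 1 : ℂ) + Complex.I *
      (fderiv ℝ φ (J.symm x) Complex.I : ℂ)) *
      Ω.indicator (fun x => (h x 0 : ℂ) - Complex.I * (h x 1 : ℂ)) (J (J.symm x)) =
      ∫ x in Ω, ((inner ℝ (h x) (gradient ψ x) : ℝ) : ℂ) -
        Complex.I * ((inner ℝ (h x) (perp (gradient ψ x)) : ℝ) : ℂ) := by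
    rw [← integral_indicator hΩ.measurableSet]
    congr 1 with x
    rw [J.apply_symm_apply]
    by_cases hx : x ∈ Ω
    · rw [indicator_of_mem hx, indicator_of_mem hx, inner_eq_sum, inner_eq_sum, perp_zero_coord,
        perp_one_coord, gradient_zero_coord, gradient_one_coord, hder, hder, hJ0, hJ1]
      push_cast
      linear_combination (-(fderiv ℝ φ (J.symm x) Complex.I : ℂ) * (h x 1 : ℂ)) * Complex.I_sq
    · rw [indicator_of_notMem hx, indicator_of_notMem hx, mul_zero]
  refine hstep.trans ?_
  have i1 := integrable_inner_of_memLp hh (memLp_gradient hψ.smooth hψ.compact Ω)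
  have i2 := integrable_inner_of_memLp hh (memLp_perp_gradient hψ.smooth hψ.compact Ω)
  rw [integral_sub i1.ofReal (i2.ofReal.const_mul _), integral_const_mul, integral_complex_ofReal,
    integral_complex_ofReal, hdiv ψ hψ, hcurl ψ hψ]
  simp

/-- The real part of a complex primitive of `h₁ - i h₂` is a potential of `(h₁, h₂)`. -/
theorem hasGradientAt_re_primitive {P : ℂ → ℂ} {c : ℂ} {x : Plane}
    (hP : HasDerivAt P c (Complex.orthonormalBasisOneI.repr.symm x)) :
    HasGradientAt (fun y => (P (Complex.orthonormalBasisOneI.repr.symm y)).re)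
      !₂[c.re, -c.im] x := by
  let J : ℂ ≃ₗᵢ[ℝ] Plane := Complex.orthonormalBasisOneI.repr
  have h1 := (hP.hasFDerivAt.restrictScalars ℝ).comp x
    J.symm.toContinuousLinearEquiv.hasFDerivAt
  have h2 := Complex.reCLM.hasFDerivAt.comp x h1
  rw [hasGradientAt_iff_hasFDerivAt]
  refine HasFDerivAt.congr_fderiv h2 ?_
  ext v
  have hv : J.symm v = ⟨v 0, v 1⟩ := by
    rw [LinearIsometryEquiv.symm_apply_eq]
    ext i
    fin_cases i <;> simp [J]
  rw [InnerProductSpace.toDual_apply_apply, inner_eq_sum]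
  have : (Complex.reCLM ((J.symm v) • c)) = (J.symm v).re * c.re - (J.symm v).im * c.im := by
    simp
  refine Eq.trans (b := Complex.reCLM ((J.symm v) • c)) (by simp [J]) ?_
  rw [this, hv]
  simp
  ring

/-- On a bounded simply connected strongly Lipschitz domain there are no nonzero harmonic fields in
`L²` with zero normal trace: such a field is the gradient of a harmonic function `p`, and testing
the zero normal trace with `arctan p` gives `∫ |h|² / (1 + p²) = 0`. -/
theorem ae_eq_zero_of_curlFree_of_zeroNormalTrace {Ω : Set Plane} (hΩ : IsOpen Ω)
    (hb : Bornology.IsBounded Ω) (hl : IsStronglyLipschitz Ω) (hs : IsSimplyConnected Ω)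
    {h : Plane → Plane} (hh : MemLp h 2 (volume.restrict Ω)) (hn : HasZeroNormalTrace Ω h)
    (hcurl : WeakCurlFree Ω h) : h =ᵐ[volume.restrict Ω] 0 := by
  have hfin : IsFiniteMeasure (volume.restrict Ω) :=
    isFiniteMeasure_restrict.2 hb.measure_lt_top.ne
  have hdiv : WeakDivFree Ω h := fun φ hφ => hn φ hφ.smooth hφ.compact
  let J : ℂ ≃ₗᵢ[ℝ] Plane := Complex.orthonormalBasisOneI.repr
  let k : Plane → ℂ := fun x => (h x 0 : ℂ) - Complex.I * (h x 1 : ℂ)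
  have hk : IntegrableOn k Ω := by
    have hint : ∀ i, Integrable (fun x => h x i) (volume.restrict Ω) := fun i =>
      (hh.eval_piLp i).integrable (by norm_num)
    exact (hint 0).ofReal.sub ((hint 1).ofReal.const_mul _)
  have hF : Integrable fun z => Ω.indicator k (J z) :=
    (J.measurePreserving.integrable_comp_emb J.toHomeomorph.measurableEmbedding).2
      (hk.integrable_indicator hΩ.measurableSet)
  have hU : IsOpen (J ⁻¹' Ω) := hΩ.preimage J.continuous
  obtain ⟨f, hf, hFf⟩ := exists_differentiableOn_ae_eq_of_weak_dbar hU hF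
    fun φ hφ hφc hφs => weak_dbar_of_div_curl_free hΩ hh hdiv hcurl hφ hφc hφs
  have hUs : IsSimplyConnected (J ⁻¹' Ω) := J.toHomeomorph.isSimplyConnected_preimage.2 hs
  obtain ⟨P, hP⟩ := isExactOn_of_isSimplyConnected hU hUs hf
  let p : Plane → ℝ := fun x => (P (J.symm x)).re
  have hmap : ∀ x ∈ Ω, J.symm x ∈ J ⁻¹' Ω := fun x hx => by
    rwa [mem_preimage, J.apply_symm_apply]
  have hp : ∀ x ∈ Ω, HasGradientAt p !₂[(f (J.symm x)).re, -(f (J.symm x)).im] x := fun x hx =>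
    hasGradientAt_re_primitive (hP _ (hmap x hx))
  have hph : ∀ᵐ x ∂volume.restrict Ω, HasGradientAt p (h x) x := by
    have h1 : ∀ᵐ x : Plane, J.symm x ∈ J ⁻¹' Ω → Ω.indicator k (J (J.symm x)) = f (J.symm x) :=
      J.symm.measurePreserving.quasiMeasurePreserving.ae hFf
    rw [ae_restrict_iff' hΩ.measurableSet]
    filter_upwards [h1] with x hx hxΩ
    have h2 := hx (hmap x hxΩ)
    rw [J.apply_symm_apply, indicator_of_mem hxΩ] at h2
    have h3 := hp x hxΩ
    rw [← h2] at h3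
    convert h3 using 1
    ext i
    fin_cases i <;> simp [k]
  have hps : ContDiffOn ℝ ∞ p Ω := by
    have hPd : DifferentiableOn ℂ P (J ⁻¹' Ω) := fun z hz =>
      (hP z hz).differentiableAt.differentiableWithinAt
    have hPs : ContDiffOn ℝ ∞ P (J ⁻¹' Ω) := (hPd.contDiffOn hU).restrict_scalars ℝ
    exact Complex.reCLM.contDiff.comp_contDiffOn (hPs.comp J.symm.contDiff.contDiffOn hmap)
  -- the bounded function `arctan p` is an admissible test function, whereas `p` may be unbounded
  let q : Plane → ℝ := fun x => Real.arctan (p x)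
  have hq : ContDiffOn ℝ ∞ q Ω := Real.contDiff_arctan.comp_contDiffOn hps
  have hqg : ∀ᵐ x ∂volume.restrict Ω, gradient q x = (1 + p x ^ 2)⁻¹ • h x := by
    filter_upwards [hph] with x hx
    have h1 := hx.hasFDerivAt.arctan
    have h2 : HasGradientAt q ((1 + p x ^ 2)⁻¹ • h x) x := by
      rw [hasGradientAt_iff_hasFDerivAt, map_smulₛₗ]
      simpa using h1
    exact h2.gradient
  have hle : ∀ x, (1 + p x ^ 2)⁻¹ ≤ 1 := fun x =>
    inv_le_one_of_one_le₀ (by nlinarith [sq_nonneg (p x)])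
  have hpos : ∀ x, 0 < (1 + p x ^ 2)⁻¹ := fun x => by positivity
  have hpm : AEStronglyMeasurable (fun x => (1 + p x ^ 2)⁻¹) (volume.restrict Ω) := by
    refine ContinuousOn.aestronglyMeasurable (ContinuousOn.inv₀ ?_ fun x _ => ?_) hΩ.measurableSet
    · exact continuousOn_const.add (hps.continuousOn.pow 2)
    · positivity
  have hsm : MemLp (fun x => (1 + p x ^ 2)⁻¹ • h x) 2 (volume.restrict Ω) := by
    refine hh.of_le (hpm.smul hh.1) (Eventually.of_forall fun x => ?_)
    rw [norm_smul, Real.norm_of_nonneg (hpos x).le]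
    exact mul_le_of_le_one_left (norm_nonneg _) (hle x)
  have hqL : MemLp (gradient q) 2 (volume.restrict Ω) :=
    hsm.ae_eq (hqg.mono fun x hx => hx.symm)
  have hzero := integral_inner_gradient_eq_zero hΩ hb hl hh hn hq
    (fun x _ => (abs_lt.2 ⟨Real.neg_pi_div_two_lt_arctan _, Real.arctan_lt_pi_div_two _⟩).le) hqL
  have hint := integrable_inner_of_memLp hh hqL
  rw [integral_eq_zero_iff_of_nonneg_ae ?_ hint] at hzero
  · filter_upwards [hzero, hqg] with x hx hx2
    rw [hx2, real_inner_smul_right, Pi.zero_apply, mul_eq_zero] at hx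
    exact inner_self_eq_zero.1 (hx.resolve_left (hpos x).ne')
  · filter_upwards [hqg] with x hx
    rw [Pi.zero_apply, hx, real_inner_smul_right]
    exact mul_nonneg (hpos x).le real_inner_self_nonneg

/-- **Helmholtz orthogonality**: on a bounded simply connected strongly Lipschitz domain, curl-free
fields are orthogonal to fields with zero normal trace. The component of `u` orthogonal to all
gradients is a harmonic field with zero normal trace, hence zero. -/
theorem integral_inner_eq_zero_of_curlFree {Ω : Set Plane} (hΩ : IsOpen Ω)
    (hb : Bornology.IsBounded Ω) (hl : IsStronglyLipschitz Ω) (hs : IsSimplyConnected Ω)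
    {u v : Plane → Plane} (hu : MemLp u 2 (volume.restrict Ω)) (hcurl : WeakCurlFree Ω u)
    (hv : MemLp v 2 (volume.restrict Ω)) (hn : HasZeroNormalTrace Ω v) :
    ∫ x in Ω, inner ℝ (u x) (v x) = 0 := by
  have : CompleteSpace (gradientSpace Ω)ᗮ :=
    (Submodule.isClosed_orthogonal (gradientSpace Ω)).completeSpace_coe
  have : (gradientSpace Ω)ᗮ.HasOrthogonalProjection := .ofCompleteSpace _
  obtain ⟨h, hh, g, hg, hug⟩ :=
    Submodule.exists_add_mem_mem_orthogonal (K := (gradientSpace Ω)ᗮ) (hu.toLp u)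
  have hutr : ∀ {w w' : Plane → Plane}, w =ᵐ[volume.restrict Ω] w' → HasZeroNormalTrace Ω w →
      HasZeroNormalTrace Ω w' := by
    intro w w' hww' hw φ hφ hφc
    rw [← hw φ hφ hφc]
    apply integral_congr_ae
    filter_upwards [hww'] with x hx
    rw [hx]
  have hort : ∀ {w : Plane → Plane} (hw : MemLp w 2 (volume.restrict Ω)),
      HasZeroNormalTrace Ω w → ∫ x in Ω, inner ℝ (g x) (w x) = 0 := by
    intro w hw hwn
    have h1 := (Submodule.mem_orthogonal' _ _).1 hg (hw.toLp w)
      (mem_gradientSpace_orthogonal.2 (hutr hw.coeFn_toLp.symm hwn))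
    rw [← h1, L2.inner_def]
    apply integral_congr_ae
    filter_upwards [hw.coeFn_toLp] with x hx
    rw [hx]
  have hsum : ∀ᵐ x ∂volume.restrict Ω, u x = h x + g x := by
    filter_upwards [hu.coeFn_toLp, Lp.coeFn_add h g] with x hx hx2
    rw [← hx, hug, hx2, Pi.add_apply]
  -- rotated gradients of test functions have zero normal trace, so `g` and hence `h` is curl-free
  have hhcurl : WeakCurlFree Ω h := by
    intro ψ hψ
    have hpm := memLp_perp_gradient hψ.smooth hψ.compact Ω
    have hg0 := hort hpm fun φ hφ _ => by
      rw [← weakCurlFree_gradient hφ ψ hψ]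
      simp only [real_inner_comm]
    have h1 := hcurl ψ hψ
    rw [integral_congr_ae (g := fun x => inner ℝ (h x) (perp (gradient ψ x)) +
      inner ℝ (g x) (perp (gradient ψ x))) (hsum.mono fun x hx => by
        simp only [hx, inner_add_left]),
      integral_add (integrable_inner_of_memLp (Lp.memLp h) hpm)
        (integrable_inner_of_memLp (Lp.memLp g) hpm), hg0, add_zero] at h1
    exact h1
  have hh0 := ae_eq_zero_of_curlFree_of_zeroNormalTrace hΩ hb hl hs (Lp.memLp h)
    (mem_gradientSpace_orthogonal.1 hh) hhcurl
  rw [← hort hv hn]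
  apply integral_congr_ae
  filter_upwards [hsum, hh0] with x hx hx2
  rw [hx, hx2, Pi.zero_apply, zero_add]

/-! ### A function on the hull that is convex along wave cone directions -/

/-- For `(ρ, v, m) ∈ Λ` with frequency `ξ` one has `ρ v₂ |ξ|² = -(ρ ξ₁)²`. -/
theorem mul_nonpos_of_mem_waveCone {z : State} (hz : z ∈ waveCone) : z.1 * z.2.1 1 ≤ 0 := by
  obtain ⟨ξ, hξ, -, h1, h2⟩ := hz
  rw [inner_eq_sum] at h1 h2
  simp only [PiLp.add_apply, vert_zero_coord, vert_one_coord, perp_zero_coord, perp_one_coord]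
    at h2
  have hpos : 0 < ξ 0 ^ 2 + ξ 1 ^ 2 := by
    by_contra hcon
    have h3 : ξ 0 = 0 := by nlinarith [sq_nonneg (ξ 0), sq_nonneg (ξ 1)]
    have h4 : ξ 1 = 0 := by nlinarith [sq_nonneg (ξ 0), sq_nonneg (ξ 1)]
    apply hξ
    ext i
    fin_cases i
    · exact h3
    · exact h4
  have h5 : z.1 * z.2.1 1 * (ξ 0 ^ 2 + ξ 1 ^ 2) = -(z.1 * ξ 0) ^ 2 := by
    linear_combination z.1 * ξ 1 * h1 + z.1 * ξ 0 * h2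
  by_contra hcon
  rw [not_le] at hcon
  nlinarith [mul_pos hcon hpos, sq_nonneg (z.1 * ξ 0)]

/-- On the lamination hull, `m₂ ≤ ρ v₂`: equality holds on `K`, and `m₂ - ρ v₂` is convex along
segments in wave cone directions. -/
theorem le_of_mem_laminationHull {z : State} (hz : z ∈ laminationHull waveCone constitutiveSet) :
    z.2.2 1 ≤ z.1 * z.2.1 1 := by
  obtain ⟨n, hn⟩ := mem_iUnion.1 hz
  clear hz
  induction n generalizing z with
  | zero =>
    obtain ⟨-, hm⟩ := (hn : z ∈ constitutiveSet)
    rw [hm]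
    simp
  | succ n ih =>
    obtain ⟨z₁, h₁, z₂, h₂, hd, t, ⟨ht0, ht1⟩, rfl⟩ := hn
    have i₁ := ih h₁
    have i₂ := ih h₂
    have hc := mul_nonpos_of_mem_waveCone hd
    simp only [Prod.fst_sub, Prod.snd_sub, PiLp.sub_apply] at hc
    simp only [Prod.fst_add, Prod.snd_add, Prod.smul_fst, Prod.smul_snd, PiLp.add_apply,
      PiLp.smul_apply, smul_eq_mul]
    nlinarith [mul_le_mul_of_nonneg_left i₁ ht0,
      mul_le_mul_of_nonneg_left i₂ (sub_nonneg.2 ht1),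
      mul_nonneg (mul_nonneg ht0 (sub_nonneg.2 ht1)) (neg_nonneg.2 hc)]

/-- The zero normal trace of `m`, tested with the coordinate function `x₂` cut off outside `Ω`. -/
theorem integral_one_coord_eq_zero {Ω : Set Plane} (hΩ : IsOpen Ω) (hb : Bornology.IsBounded Ω)
    {m : Plane → Plane} (hn : HasZeroNormalTrace Ω m) : ∫ x in Ω, m x 1 = 0 := by
  obtain ⟨χ, hχ, hχc, -, hχ1⟩ := exists_smooth_cutoff hb.isCompact_closure isOpen_univ
    (subset_univ _)
  rw [← hn (fun x => χ x * x 1) (hχ.mul (by fun_prop)) hχc.mul_right]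
  refine setIntegral_congr_fun hΩ.measurableSet fun x hx => ?_
  have h1 : HasFDerivAt (fun y : Plane => y 1) (EuclideanSpace.proj 1 : Plane →L[ℝ] ℝ) x :=
    (EuclideanSpace.proj 1 : Plane →L[ℝ] ℝ).hasFDerivAt
  have h2 : (fun y : Plane => χ y * y 1) =ᶠ[𝓝 x] fun y => y 1 := by
    filter_upwards [hχ1 x (subset_closure hx)] with y hy
    rw [hy, one_mul]
  simp only [inner_eq_sum, gradient_congr h2, gradient_zero_coord, gradient_one_coord, h1.fderiv]
  simp

end StationaryIPM

theorem theorem2 (Ω : Set StationaryIPM.Plane)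
    (hΩ_open : IsOpen Ω) (hΩ_bdd : Bornology.IsBounded Ω)
    (hΩ_lip : StationaryIPM.IsStronglyLipschitz Ω)
    (hΩ_sc : IsSimplyConnected Ω)
    (ρ : StationaryIPM.Plane → ℝ) (v m : StationaryIPM.Plane → StationaryIPM.Plane)
    (hρ : MemLp ρ ∞ (volume.restrict Ω))
    (hv : StationaryIPM.MemL2Sigma Ω v) (hm : StationaryIPM.MemL2Sigma Ω m)
    (hsys : StationaryIPM.SolvesLinearIPM Ω ρ v m)
    (hhull : ∀ᵐ x ∂(volume.restrict Ω), (ρ x, v x, m x) ∈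
      StationaryIPM.laminationHull StationaryIPM.waveCone StationaryIPM.constitutiveSet) :
    v =ᵐ[volume.restrict Ω] 0 ∧
      StationaryIPM.HasWeakPartialDeriv Ω 0 ρ 0 := by
  have hfin : IsFiniteMeasure (volume.restrict Ω) :=
    isFiniteMeasure_restrict.2 hΩ_bdd.measure_lt_top.ne
  have hρ2 : MemLp ρ 2 (volume.restrict Ω) := hρ.mono_exponent le_top
  have hvert : MemLp (fun x => StationaryIPM.vert (ρ x)) 2 (volume.restrict Ω) := by
    refine memLp_piLp_iff.2 fun i => ?_
    fin_cases i
    · exact MemLp.zero'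
    · exact hρ2
  have hu : MemLp (fun x => v x + StationaryIPM.vert (ρ x)) 2 (volume.restrict Ω) :=
    hv.memLp.add hvert
  have hortho := StationaryIPM.integral_inner_eq_zero_of_curlFree hΩ_open hΩ_bdd hΩ_lip hΩ_sc hu
    hsys.darcy hv.memLp hv.normalTrace
  have hm0 := StationaryIPM.integral_one_coord_eq_zero hΩ_open hΩ_bdd hm.normalTrace
  have hmint : Integrable (fun x => m x 1) (volume.restrict Ω) :=
    (hm.memLp.eval_piLp 1).integrable (by norm_num)
  have huint := StationaryIPM.integrable_inner_of_memLp hu hv.memLp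
  -- pointwise, the energy density `(v + (0, ρ)) · v` dominates `|v|² + m₂`
  have hlow : ∀ᵐ x ∂(volume.restrict Ω), inner ℝ (v x) (v x) ≤
      inner ℝ (v x + StationaryIPM.vert (ρ x)) (v x) - m x 1 := by
    filter_upwards [hhull] with x hx
    have := StationaryIPM.le_of_mem_laminationHull hx
    rw [inner_add_left, StationaryIPM.inner_eq_sum (StationaryIPM.vert (ρ x))]
    simp only [StationaryIPM.vert_zero_coord, StationaryIPM.vert_one_coord] at this ⊢
    linarith
  have hzero : ∫ x in Ω, (inner ℝ (v x + StationaryIPM.vert (ρ x)) (v x) - m x 1) = 0 := by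
    rw [integral_sub huint hmint, hortho, hm0, sub_zero]
  rw [integral_eq_zero_iff_of_nonneg_ae
    (hlow.mono fun x hx => real_inner_self_nonneg.trans hx) (huint.sub hmint)] at hzero
  have hv0 : v =ᵐ[volume.restrict Ω] 0 := by
    filter_upwards [hlow, hzero] with x hx hx0
    rw [hx0] at hx
    exact real_inner_self_nonpos.1 hx
  refine ⟨hv0, fun φ hφ => ?_⟩
  have h1 := hsys.darcy φ hφ
  rw [integral_congr_ae (g := fun x => ρ x * gradient φ x 0) (hv0.mono fun x hx => by
    simp only [hx, StationaryIPM.inner_eq_sum]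
    simp)] at h1
  rw [h1]
  simp
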